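/- Let $\bar M$ be a $2k$-dimensional smooth manifold with an indefinite Kähler structure: a semi-Riemannian metric $\bar g$ of constant index $q$, $0<q<2k$, with Levi-Civita connection $\bar\nabla$, and an almost complex structure $\bar J$ ($\bar J^2=-I$) with $\bar g(\bar JX,\bar JY)=\bar g(X,Y)$ and $\bar\nabla\bar J=0$. Let $M$ be an $m$-dimensional (immersed) lightlike submanifold of $\bar M$, i.e. $Rad(TM)=TM\cap TM^\perp$ has constant rank $r$ with $1\le r\le m$. Fix non-degenerate complements, the screen distribution $S(TM)$ and the screen transversal bundle $S(TM^\perp)$, with $$TM=S(TM)\perp Rad(TM),\qquad TM^\perp=S(TM^\perp)\perp Rad(TM),$$ and a lightlike transversal bundle $ltr(TM)$, i.e. a totally null smooth subbundle with $S(TM)^\perp\cap S(TM^\perp)^\perp=Rad(TM)\oplus ltr(TM)$. Put $tr(TM)=ltr(TM)\perp S(TM^\perp)$, so that $T\bar M|_M=TM\oplus tr(TM)$, and for vector fields $X,Y$ on $M$ let $h(X,Y)$ be the component of $\bar\nabla_XY$ in $tr(TM)$. Assume that $M$ is a screen transversal Cauchy–Riemann (STCR) lightlike submanifold: there are smooth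 subbundles $D_1,D_2$ of $Rad(TM)$, $D_0,D'$ of $S(TM)$, $L_1$ of $ltr(TM)$ and $S$ of $S(TM^\perp)$ with $$Rad(TM)=D_1\oplus D_2,\quad \bar J(D_1)\subset S(TM),\quad \bar J(D_2)\subset S(TM^\perp),$$ $$S(TM)=\{\bar J D_1\oplus D'\}\perp D_0,\quad \bar J(D_0)=D_0,\quad \bar J(D')=L_1\perp S,$$ and $D_0$ non-degenerate. Let $D=D_0\oplus D_1\oplus\bar JD_1$, and let $\Gamma(D)$ be the smooth vector fields on $M$ with values in $D$. Then $D$ defines a totally geodesic foliation in $\bar M$ (that is, $[X,Y]\in\Gamma(D)$ and $\bar\nabla_XY\in\Gamma(D)$ for all $X,Y\in\Gamma(D)$) if and only if $M$ is $D$-geodesic (that is, $h(X,Y)=0$ for all $X,Y\in\Gamma(D)$). -/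

import Mathlib

open scoped Manifold ContDiff Topology

noncomputable section

namespace STCR

/-! ### Linear algebra of the lightlike decomposition -/

/-- `B` restricts to a nondegenerate form on the subspace `W`. -/
def NondegenerateOn {V : Type*} [AddCommGroup V] [Module ℝ V]
    (B : LinearMap.BilinForm ℝ V) (W : Submodule ℝ V) : Prop :=
  (B.restrict W).Nondegenerate

/-- Every vector of `U` is `B`-orthogonal to every vector of `W`. -/
def OrthogonalSubspaces {V : Type*} [AddCommGroup V] [Module ℝ V]
    (B : LinearMap.BilinForm ℝ V) (U W : Submodule ℝ V) : Prop :=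
  ∀ u ∈ U, ∀ w ∈ W, B u w = 0

/-- `W` is the (internal) direct sum `U₁ ⊕ U₂`. -/
def IsDirectSum {V : Type*} [AddCommGroup V] [Module ℝ V] (W U₁ U₂ : Submodule ℝ V) : Prop :=
  U₁ ⊔ U₂ = W ∧ Disjoint U₁ U₂

/-- If `T = S ⊕ R` with `R = T ∩ T^⊥`, `S` and `C ⊆ T^⊥` are nondegenerate, and
`S^⊥ ∩ C^⊥ = R ⊕ L`, then `V = T ⊕ (L ⊕ C)`. -/
theorem isCompl_tangent_transversal {V : Type*} [AddCommGroup V] [Module ℝ V]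
    [FiniteDimensional ℝ V] (B : LinearMap.BilinForm ℝ V) (hB : ∀ u v, B u v = B v u)
    (T S C L : Submodule ℝ V) (hS : IsDirectSum T S (T ⊓ B.orthogonal T))
    (hSn : NondegenerateOn B S) (hC : C ≤ B.orthogonal T) (hCn : NondegenerateOn B C)
    (hL : IsDirectSum (B.orthogonal S ⊓ B.orthogonal C) (T ⊓ B.orthogonal T) L) :
    IsCompl T (L ⊔ C) := by
  have hr : B.IsRefl := fun x y h => by rw [hB]; exact h
  have hcS := LinearMap.BilinForm.isCompl_orthogonal_of_restrict_nondegenerate hr hSn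
  have hcC := LinearMap.BilinForm.isCompl_orthogonal_of_restrict_nondegenerate hr hCn
  have hST : S ≤ T := hS.1 ▸ le_sup_left
  have hLW : L ≤ B.orthogonal S ⊓ B.orthogonal C := hL.1 ▸ le_sup_right
  constructor
  · rw [Submodule.disjoint_def]
    intro u hu huLC
    obtain ⟨n, hn, w, hw, rfl⟩ := Submodule.mem_sup.1 huLC
    have hw0 : w = 0 := by
      refine (Submodule.disjoint_def.1 hcC.disjoint) w hw ?_
      intro c hc
      have h1 : B c (n + w) = 0 := by rw [hB]; exact hC hc _ hu
      have h2 : B c n = 0 := (hLW hn).2 c hc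
      change B c w = 0
      rw [map_add, h2, zero_add] at h1
      exact h1
    subst hw0
    rw [add_zero] at hu ⊢
    obtain ⟨s, hs, x, hx, hsx⟩ := Submodule.mem_sup.1 (hS.1 ▸ hu)
    have hs0 : s = 0 := by
      refine (Submodule.disjoint_def.1 hcS.disjoint) s hs ?_
      intro c hc
      have h1 : B c n = 0 := (hLW hn).1 c hc
      have h2 : B c x = 0 := hx.2 c (hST hc)
      change B c s = 0
      rw [← hsx, map_add, h2, add_zero] at h1
      exact h1
    rw [hs0, zero_add] at hsx
    exact (Submodule.disjoint_def.1 hL.2) n (hsx ▸ hx) hn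
  · rw [codisjoint_iff, eq_top_iff]
    intro v _
    obtain ⟨s, hs, t, ht, rfl⟩ := Submodule.mem_sup.1
      (show v ∈ S ⊔ B.orthogonal S by rw [hcS.sup_eq_top]; trivial)
    obtain ⟨c, hc, w, hw, rfl⟩ := Submodule.mem_sup.1
      (show t ∈ C ⊔ B.orthogonal C by rw [hcC.sup_eq_top]; trivial)
    have hcS' : c ∈ B.orthogonal S := fun x hx => hC hc x (hST hx)
    have hwS : w ∈ B.orthogonal S := by
      have := Submodule.sub_mem _ ht hcS'
      rwa [add_sub_cancel_left] at this
    obtain ⟨x, hx, n, hn, rfl⟩ := Submodule.mem_sup.1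
      (show w ∈ (T ⊓ B.orthogonal T) ⊔ L by rw [hL.1]; exact ⟨hwS, hw⟩)
    refine Submodule.add_mem _ (Submodule.mem_sup_left (hST hs)) (Submodule.add_mem _
      (Submodule.mem_sup_right (Submodule.mem_sup_right hc)) (Submodule.add_mem _
      (Submodule.mem_sup_left hx.1) (Submodule.mem_sup_right (Submodule.mem_sup_left hn))))

/-! ### Indefinite Kähler manifolds -/

/-- A smooth semi-Riemannian metric on the `N`-dimensional manifold `Mbar`: a smooth field of
nondegenerate symmetric bilinear forms on the tangent spaces. -/
structure SemiRiemannianMetric (N : ℕ) (Mbar : Type*) [TopologicalSpace Mbar]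
    [ChartedSpace (EuclideanSpace ℝ (Fin N)) Mbar] [IsManifold (𝓡 N) ∞ Mbar] where
  form : ∀ x : Mbar, TangentSpace (𝓡 N) x →L[ℝ] TangentSpace (𝓡 N) x →L[ℝ] ℝ
  symm : ∀ x u v, form x u v = form x v u
  nondegenerate : ∀ x u, (∀ v, form x u v = 0) → u = 0
  contMDiff : ContMDiff (𝓡 N)
    ((𝓡 N).prod 𝓘(ℝ, EuclideanSpace ℝ (Fin N) →L[ℝ] EuclideanSpace ℝ (Fin N) →L[ℝ] ℝ)) ∞
    (fun x => Bundle.TotalSpace.mk'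
      (EuclideanSpace ℝ (Fin N) →L[ℝ] EuclideanSpace ℝ (Fin N) →L[ℝ] ℝ)
      (E := fun x : Mbar => TangentSpace (𝓡 N) x →L[ℝ] TangentSpace (𝓡 N) x →L[ℝ] ℝ)
      x (form x))

section Ambient

variable {N : ℕ} {Mbar : Type*} [TopologicalSpace Mbar]
    [ChartedSpace (EuclideanSpace ℝ (Fin N)) Mbar] [IsManifold (𝓡 N) ∞ Mbar]

/-- The metric at `x` as a bilinear form on the tangent space. -/
def SemiRiemannianMetric.bilin (g : SemiRiemannianMetric N Mbar) (x : Mbar) :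
    LinearMap.BilinForm ℝ (TangentSpace (𝓡 N) x) :=
  (g.form x).toBilinForm

/-- The index of the metric at `x`: the largest dimension of a subspace of the tangent space
on which the metric is negative definite. -/
def SemiRiemannianMetric.index (g : SemiRiemannianMetric N Mbar) (x : Mbar) : ℕ :=
  sigNeg (g.bilin x).toQuadraticMap

/-- `∇` is the Levi-Civita connection of `g`: it is torsion free, and
`v (g(σ, τ)) = g(∇_v σ, τ) + g(σ, ∇_v τ)` (where `∇_v σ` is written `cov σ x v`). -/
structure IsLeviCivita (g : SemiRiemannianMetric N Mbar)
    (cov : CovariantDerivative (𝓡 N) (EuclideanSpace ℝ (Fin N))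
      (TangentSpace (𝓡 N) : Mbar → Type _)) : Prop where
  torsion_free : cov.torsion = 0
  metric : ∀ (σ τ : ∀ x : Mbar, TangentSpace (𝓡 N) x) (x : Mbar),
    MDifferentiableAt (𝓡 N) (𝓡 N).tangent
      (fun y => (⟨y, σ y⟩ : TangentBundle (𝓡 N) Mbar)) x →
    MDifferentiableAt (𝓡 N) (𝓡 N).tangent
      (fun y => (⟨y, τ y⟩ : TangentBundle (𝓡 N) Mbar)) x →
    ∀ v : TangentSpace (𝓡 N) x,
      mvfderiv (𝓡 N) (fun y => g.form y (σ y) (τ y)) x v =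
        g.form x (cov σ x v) (τ x) + g.form x (σ x) (cov τ x v)

end Ambient

/-- The structure of an indefinite Kähler manifold on the `N`-dimensional manifold `Mbar`:
a semi-Riemannian metric of constant index `q`, `0 < q < N`, its Levi-Civita connection, and a
Hermitian almost complex structure that is parallel for this connection. -/
structure IndefiniteKaehler (N q : ℕ) (Mbar : Type*) [TopologicalSpace Mbar]
    [ChartedSpace (EuclideanSpace ℝ (Fin N)) Mbar] [IsManifold (𝓡 N) ∞ Mbar] where
  g : SemiRiemannianMetric N Mbar
  index_pos : 0 < q
  index_lt : q < N
  index_eq : ∀ x, g.index x = q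
  cov : CovariantDerivative (𝓡 N) (EuclideanSpace ℝ (Fin N)) (TangentSpace (𝓡 N) : Mbar → Type _)
  leviCivita : IsLeviCivita g cov
  J : ∀ x : Mbar, TangentSpace (𝓡 N) x →L[ℝ] TangentSpace (𝓡 N) x
  J_contMDiff : ContMDiff (𝓡 N)
    ((𝓡 N).prod 𝓘(ℝ, EuclideanSpace ℝ (Fin N) →L[ℝ] EuclideanSpace ℝ (Fin N))) ∞
    (fun x => Bundle.TotalSpace.mk' (EuclideanSpace ℝ (Fin N) →L[ℝ] EuclideanSpace ℝ (Fin N))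
      (E := fun x : Mbar => TangentSpace (𝓡 N) x →L[ℝ] TangentSpace (𝓡 N) x) x (J x))
  J_sq : ∀ x u, J x (J x u) = -u
  hermitian : ∀ x u v, g.form x (J x u) (J x v) = g.form x u v
  parallel : ∀ (σ : ∀ x : Mbar, TangentSpace (𝓡 N) x) (x : Mbar),
    MDifferentiableAt (𝓡 N) (𝓡 N).tangent
      (fun y => (⟨y, σ y⟩ : TangentBundle (𝓡 N) Mbar)) x →
    ∀ v : TangentSpace (𝓡 N) x, cov (fun y => J y (σ y)) x v = J x (cov σ x v)

/-! ### Submanifolds -/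

section Submanifold

variable (m : ℕ) {N : ℕ} {M : Type*} [TopologicalSpace M]
    [ChartedSpace (EuclideanSpace ℝ (Fin m)) M] [IsManifold (𝓡 m) ∞ M]
    {Mbar : Type*} [TopologicalSpace Mbar]
    [ChartedSpace (EuclideanSpace ℝ (Fin N)) Mbar] [IsManifold (𝓡 N) ∞ Mbar]

/-- `ι` makes `M` an (immersed) submanifold of `Mbar`. -/
structure IsSubmanifold (ι : M → Mbar) : Prop where
  contMDiff : ContMDiff (𝓡 m) (𝓡 N) ∞ ι
  injective_mfderiv : ∀ p, Function.Injective (mfderiv (𝓡 m) (𝓡 N) ι p)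

/-- A field of subspaces of the tangent spaces of `Mbar` along `ι`. Subbundles of `TMbar|_M`, and
those of `TM` (through the identification of `TM` with its image under the differential of `ι`),
are such fields. -/
abbrev SubspaceField (ι : M → Mbar) : Type _ :=
  ∀ p : M, Submodule ℝ (TangentSpace (𝓡 N) (ι p))

/-- The field is a smooth vector subbundle of `TMbar|_M`: near every point it is spanned by a
smooth local frame. -/
def IsSmoothSubbundle (ι : M → Mbar) (F : SubspaceField (N := N) ι) : Prop :=
  ∀ p₀ : M, ∃ (d : ℕ) (s : Fin d → ∀ p : M, TangentSpace (𝓡 N) (ι p)), ∀ᶠ p in 𝓝 p₀,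
    (∀ i, ContMDiffAt (𝓡 m) (𝓡 N).tangent ∞
      (fun r => (⟨ι r, s i r⟩ : TangentBundle (𝓡 N) Mbar)) p) ∧
    LinearIndependent ℝ (fun i => s i p) ∧
    Submodule.span ℝ (Set.range fun i => s i p) = F p

/-- The tangent bundle `TM`, as a subbundle of `TMbar|_M`. -/
def tangentField (ι : M → Mbar) : SubspaceField (N := N) ι :=
  fun p => LinearMap.range (mfderiv (𝓡 m) (𝓡 N) ι p).toLinearMap

/-- The orthogonal complement in `TMbar|_M`. -/
def perp (g : SemiRiemannianMetric N Mbar) {ι : M → Mbar}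
    (F : SubspaceField (N := N) ι) : SubspaceField (N := N) ι :=
  fun p => (g.bilin (ι p)).orthogonal (F p)

/-- `Rad(TM) = TM ∩ TM^⊥`. -/
def radical (g : SemiRiemannianMetric N Mbar) (ι : M → Mbar) :
    SubspaceField (N := N) ι :=
  fun p => tangentField m ι p ⊓ perp g (tangentField m ι) p

/-- A lightlike submanifold `(M, g, S(TM), S(TM^⊥))` with radical of rank `r ≥ 1`, together with
its lightlike transversal bundle `ltr(TM)`.

The lightlike transversal bundle is a totally null complement of `Rad(TM)` in the orthogonal
complement `S(TM)^⊥ ∩ S(TM^⊥)^⊥` of `S(TM^⊥)` in `S(TM)^⊥`. That complement is nondegenerate,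
so the bundles with this property are exactly the spans of local frames `N_i` with
`g(ξ_i, N_j) = δ_ij` and `g(N_i, N_j) = 0` for a local frame `ξ_i` of `Rad(TM)`. -/
structure LightlikeSubmanifold (g : SemiRiemannianMetric N Mbar) (ι : M → Mbar) (r : ℕ) where
  isSubmanifold : IsSubmanifold m (N := N) ι
  one_le_rank : 1 ≤ r
  rank_le : r ≤ m
  rank_radical : ∀ p, Module.finrank ℝ (radical m g ι p) = r
  /-- the screen distribution `S(TM)` -/
  screen : SubspaceField (N := N) ι
  screen_smooth : IsSmoothSubbundle m ι screen
  screen_nondegenerate : ∀ p, NondegenerateOn (g.bilin (ι p)) (screen p)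
  tangent_eq : ∀ p, IsDirectSum (tangentField m ι p) (screen p) (radical m g ι p)
  /-- the screen transversal bundle `S(TM^⊥)` -/
  coscreen : SubspaceField (N := N) ι
  coscreen_smooth : IsSmoothSubbundle m ι coscreen
  coscreen_nondegenerate : ∀ p, NondegenerateOn (g.bilin (ι p)) (coscreen p)
  normal_eq : ∀ p,
    IsDirectSum (perp g (tangentField m ι) p) (coscreen p) (radical m g ι p)
  /-- the lightlike transversal bundle `ltr(TM)` -/
  ltr : SubspaceField (N := N) ι
  ltr_smooth : IsSmoothSubbundle m ι ltr
  ltr_complement : ∀ p,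
    IsDirectSum (perp g screen p ⊓ perp g coscreen p) (radical m g ι p) (ltr p)
  ltr_null : ∀ p, OrthogonalSubspaces (g.bilin (ι p)) (ltr p) (ltr p)

namespace LightlikeSubmanifold

variable {m} {g : SemiRiemannianMetric N Mbar} {ι : M → Mbar} {r : ℕ}

/-- The transversal vector bundle `tr(TM) = ltr(TM) ⊥ S(TM^⊥)`. -/
def transversal (L : LightlikeSubmanifold m g ι r) : SubspaceField (N := N) ι :=
  fun p => L.ltr p ⊔ L.coscreen p

/-- `TMbar|_M = TM ⊕ tr(TM)`. -/
theorem isCompl (L : LightlikeSubmanifold m g ι r) (p : M) :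
    IsCompl (L.transversal p) (tangentField m ι p) := by
  have : FiniteDimensional ℝ (TangentSpace (𝓡 N) (ι p)) :=
    inferInstanceAs (FiniteDimensional ℝ (EuclideanSpace ℝ (Fin N)))
  refine (isCompl_tangent_transversal (g.bilin (ι p)) (fun u v => g.symm _ u v)
    (tangentField m ι p) (L.screen p) (L.coscreen p) (L.ltr p) (L.tangent_eq p)
    (L.screen_nondegenerate p) ?_ (L.coscreen_nondegenerate p) (L.ltr_complement p)).symm
  exact le_sup_left.trans (L.normal_eq p).1.le

end LightlikeSubmanifold

/-! ### Differentiation along the submanifold -/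

variable {m} in
/-- The covariant derivative `∇_v V` of a vector field `V` along `ι`, in the direction
`v ∈ T_p M` (that is, for the connection induced by `cov` on `TMbar|_M`). Let `e_i` be the
frame given by the trivialization of `TMbar` at `ι p` and write `V = ∑ V^i e_i` near `p`. Then
`∇_v V = ∑ (v V^i) e_i + ∇_{dι v} (∑ V^i(p) e_i)`; the field with constant components in the
last term is `FiberBundle.extend _ (V p)`. -/
def covAlong (cov : CovariantDerivative (𝓡 N) (EuclideanSpace ℝ (Fin N))
      (TangentSpace (𝓡 N) : Mbar → Type _)) (ι : M → Mbar)
    (V : ∀ p : M, TangentSpace (𝓡 N) (ι p)) (p : M) (v : TangentSpace (𝓡 m) p) :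
    TangentSpace (𝓡 N) (ι p) :=
  let e := trivializationAt (EuclideanSpace ℝ (Fin N)) (TangentSpace (𝓡 N) : Mbar → Type _) (ι p)
  e.symm (ι p) (mvfderiv (𝓡 m) (fun q => (e ⟨ι q, V q⟩).2) p v) +
    cov (FiberBundle.extend (EuclideanSpace ℝ (Fin N)) (V p)) (ι p)
      (mfderiv (𝓡 m) (𝓡 N) ι p v)

variable {m} in
/-- `∇bar_X Y`, a vector field along `ι`, for vector fields `X`, `Y` on `M`. -/
def nablaBar (cov : CovariantDerivative (𝓡 N) (EuclideanSpace ℝ (Fin N))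
      (TangentSpace (𝓡 N) : Mbar → Type _)) (ι : M → Mbar)
    (X Y : ∀ p : M, TangentSpace (𝓡 m) p) (p : M) : TangentSpace (𝓡 N) (ι p) :=
  covAlong cov ι (fun q => mfderiv (𝓡 m) (𝓡 N) ι q (Y q)) p (X p)

variable {m} in
/-- The second fundamental form `h(X, Y)`: the component of `∇bar_X Y` in `tr(TM)` for the
decomposition `TMbar|_M = TM ⊕ tr(TM)`. -/
def LightlikeSubmanifold.secondFundamentalForm {g : SemiRiemannianMetric N Mbar} {ι : M → Mbar}
    {r : ℕ} (L : LightlikeSubmanifold m g ι r)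
    (cov : CovariantDerivative (𝓡 N) (EuclideanSpace ℝ (Fin N))
      (TangentSpace (𝓡 N) : Mbar → Type _))
    (X Y : ∀ p : M, TangentSpace (𝓡 m) p) (p : M) : TangentSpace (𝓡 N) (ι p) :=
  (L.transversal p).projection (tangentField m ι p) (L.isCompl p) (nablaBar cov ι X Y p)

/-- `X ∈ Γ(D)`: `X` is a smooth vector field on `M` with values in the distribution `D`. -/
structure IsSection (ι : M → Mbar) (D : SubspaceField (N := N) ι)
    (X : ∀ p : M, TangentSpace (𝓡 m) p) : Prop where
  contMDiff : ContMDiff (𝓡 m) (𝓡 m).tangent ∞ (fun p => (⟨p, X p⟩ : TangentBundle (𝓡 m) M))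
  mem : ∀ p, mfderiv (𝓡 m) (𝓡 N) ι p (X p) ∈ D p

/-- The distribution `D` on `M` defines a totally geodesic foliation in `Mbar`: it is integrable
(involutive), and `∇bar_X Y` is a section of `D` for all sections `X`, `Y` of `D`, that is, the
leaves of `D` are totally geodesic in `Mbar`. -/
structure IsTotallyGeodesicFoliation (cov : CovariantDerivative (𝓡 N) (EuclideanSpace ℝ (Fin N))
      (TangentSpace (𝓡 N) : Mbar → Type _))
    (ι : M → Mbar) (D : SubspaceField (N := N) ι) : Prop where
  involutive : ∀ X Y, IsSection m ι D X → IsSection m ι D Y →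
    IsSection m ι D (VectorField.mlieBracket (𝓡 m) X Y)
  geodesic : ∀ X Y, IsSection m ι D X → IsSection m ι D Y → ∀ p, nablaBar cov ι X Y p ∈ D p

/-- A screen transversal Cauchy-Riemann (STCR) lightlike submanifold of an indefinite Kähler
manifold. The almost complex structure is extended to fields of subspaces by `Submodule.map`. -/
structure STCRLightlikeSubmanifold {q : ℕ} (K : IndefiniteKaehler N q Mbar) (ι : M → Mbar) (r : ℕ)
    extends LightlikeSubmanifold m K.g ι r where
  /-- `D₁ ⊆ Rad(TM)` -/
  D₁ : SubspaceField (N := N) ι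
  /-- `D₂ ⊆ Rad(TM)` -/
  D₂ : SubspaceField (N := N) ι
  /-- `D₀ ⊆ S(TM)` -/
  D₀ : SubspaceField (N := N) ι
  /-- `D' ⊆ S(TM)` -/
  D' : SubspaceField (N := N) ι
  /-- `L₁ ⊆ ltr(TM)` -/
  L₁ : SubspaceField (N := N) ι
  /-- `S ⊆ S(TM^⊥)` -/
  S : SubspaceField (N := N) ι
  D₁_smooth : IsSmoothSubbundle m ι D₁
  D₂_smooth : IsSmoothSubbundle m ι D₂
  D₀_smooth : IsSmoothSubbundle m ι D₀
  D'_smooth : IsSmoothSubbundle m ι D'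
  L₁_smooth : IsSmoothSubbundle m ι L₁
  S_smooth : IsSmoothSubbundle m ι S
  /-- `Rad(TM) = D₁ ⊕ D₂` -/
  radical_eq : ∀ p, IsDirectSum (radical m K.g ι p) (D₁ p) (D₂ p)
  /-- `J D₁ ⊆ S(TM)` -/
  J_D₁ : ∀ p, (D₁ p).map (K.J (ι p)).toLinearMap ≤ screen p
  /-- `J D₂ ⊆ S(TM^⊥)` -/
  J_D₂ : ∀ p, (D₂ p).map (K.J (ι p)).toLinearMap ≤ coscreen p
  /-- the sum `J D₁ ⊕ D'` is direct -/
  JD₁_D'_disjoint : ∀ p, Disjoint ((D₁ p).map (K.J (ι p)).toLinearMap) (D' p)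
  /-- `S(TM) = {J D₁ ⊕ D'} ⊥ D₀` -/
  screen_eq : ∀ p,
    IsDirectSum (screen p) ((D₁ p).map (K.J (ι p)).toLinearMap ⊔ D' p) (D₀ p)
  screen_orthogonal : ∀ p, OrthogonalSubspaces (K.g.bilin (ι p))
    ((D₁ p).map (K.J (ι p)).toLinearMap ⊔ D' p) (D₀ p)
  D₀_nondegenerate : ∀ p, NondegenerateOn (K.g.bilin (ι p)) (D₀ p)
  /-- `J D₀ = D₀` -/
  J_D₀ : ∀ p, (D₀ p).map (K.J (ι p)).toLinearMap = D₀ p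
  L₁_le : ∀ p, L₁ p ≤ ltr p
  S_le : ∀ p, S p ≤ coscreen p
  /-- `J D' = L₁ ⊥ S` -/
  J_D' : ∀ p, IsDirectSum ((D' p).map (K.J (ι p)).toLinearMap) (L₁ p) (S p)
  L₁_S_orthogonal : ∀ p, OrthogonalSubspaces (K.g.bilin (ι p)) (L₁ p) (S p)

namespace STCRLightlikeSubmanifold

variable {m} {q : ℕ} {K : IndefiniteKaehler N q Mbar} {ι : M → Mbar} {r : ℕ}

/-- The distribution `D = D₀ ⊕ D₁ ⊕ J D₁` on `M`. -/
def D (L : STCRLightlikeSubmanifold m K ι r) : SubspaceField (N := N) ι :=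
  fun p => L.D₀ p ⊔ L.D₁ p ⊔ (L.D₁ p).map (K.J (ι p)).toLinearMap

/-- `M` is `D`-geodesic: `h(X, Y) = 0` for all sections `X`, `Y` of `D`. -/
def IsDGeodesic (L : STCRLightlikeSubmanifold m K ι r) : Prop :=
  ∀ X Y, IsSection m ι L.D X → IsSection m ι L.D Y →
    ∀ p, L.secondFundamentalForm K.cov X Y p = 0

end STCRLightlikeSubmanifold

end Submanifold

end STCR

end

/-! Everything rests on `D` being the largest `J`-invariant part of `TM`: a tangent vector whose
image under `J` is again tangent lies in `D`, because `J` carries the remaining summands `D'` and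
`D₂` into `tr(TM)` (`mem_D_of_J_mem_tangentField`).

Since `h` is the projection onto `tr(TM)` along `TM`, being `D`-geodesic means that `∇bar_X Y` is
tangent to `M` for all sections `X`, `Y` of `D`. A totally geodesic foliation has this property
because `D ⊆ TM`. Conversely, if `Y` is a section of `D`, so is `JY`; hence both `∇bar_X Y` and `J
∇bar_X Y = ∇bar_X JY` are tangent, and `∇bar_X Y` lies in `D` by maximality. Involutivity follows
from vanishing torsion: the image of `[X, Y]` is `∇bar_X Y - ∇bar_Y X`.

The analytic work is to carry two properties of the ambient connection over to fields defined only
along `ι`, where `∇bar` is given by a coordinate formula: `covAlong_parallel` for `∇bar J = 0` and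
`nablaBar_sub_nablaBar` for torsion. In addition, `contMDiff_of_mfderiv` is needed to know that `JY`
comes from a smooth field on `M`. -/

open scoped Manifold ContDiff Topology

noncomputable section

namespace STCR

/-! ### Calculus on manifolds: the product rule and the Lie bracket as a commutator of derivations.
-/

section Calculus

open VectorField

variable {n : ℕ} {B : Type*} [TopologicalSpace B]
    [ChartedSpace (EuclideanSpace ℝ (Fin n)) B]
    {F : Type*} [NormedAddCommGroup F] [NormedSpace ℝ F]

theorem mvfderiv_congr {f g : B → F} {x : B} (h : f =ᶠ[𝓝 x] g) :
    mvfderiv (𝓡 n) f x = mvfderiv (𝓡 n) g x :=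
  h.mfderiv_eq

theorem mvfderiv_fderiv_comp {G : Type*} [NormedAddCommGroup G] [NormedSpace ℝ G]
    {φ : F → G} {f : B → F} {x : B} (hφ : DifferentiableAt ℝ φ (f x))
    (hf : MDifferentiableAt (𝓡 n) 𝓘(ℝ, F) f x) (v : TangentSpace (𝓡 n) x) :
    mvfderiv (𝓡 n) (fun y => φ (f y)) x v = fderiv ℝ φ (f x) (mvfderiv (𝓡 n) f x v) := by
  have := mfderiv_comp x hφ.mdifferentiableAt hf
  rw [mfderiv_eq_fderiv] at this
  exact congrArg (fun L => L v) this

theorem mvfderiv_comp_mfderiv {k : ℕ} {B' : Type*} [TopologicalSpace B']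
    [ChartedSpace (EuclideanSpace ℝ (Fin k)) B']
    {φ : B → F} {f : B' → B} {x : B'} (hφ : MDifferentiableAt (𝓡 n) 𝓘(ℝ, F) φ (f x))
    (hf : MDifferentiableAt (𝓡 k) (𝓡 n) f x) (v : TangentSpace (𝓡 k) x) :
    mvfderiv (𝓡 k) (fun y => φ (f y)) x v =
      mvfderiv (𝓡 n) φ (f x) (mfderiv (𝓡 k) (𝓡 n) f x v) :=
  congrArg (fun L => L v) (mfderiv_comp x hφ hf)

theorem mvfderiv_clm_apply {G : Type*} [NormedAddCommGroup G] [NormedSpace ℝ G]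
    {A : B → F →L[ℝ] G} {f : B → F} {x : B}
    (hA : MDifferentiableAt (𝓡 n) 𝓘(ℝ, F →L[ℝ] G) A x)
    (hf : MDifferentiableAt (𝓡 n) 𝓘(ℝ, F) f x) (v : TangentSpace (𝓡 n) x) :
    mvfderiv (𝓡 n) (fun y => A y (f y)) x v =
      mvfderiv (𝓡 n) A x v (f x) + A x (mvfderiv (𝓡 n) f x v) := by
  -- Evaluation is a differentiable map on the product space, so the chain rule reduces the claim to
  -- the product rule in normed spaces.
  have h1 := mvfderiv_fderiv_comp (n := n) (φ := fun q : (F →L[ℝ] G) × F => q.1 q.2)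
    (f := fun y => (A y, f y)) (x := x)
    (differentiableAt_fst.clm_apply differentiableAt_snd) (hA.prodMk_space hf) v
  rw [h1]
  rw [fderiv_clm_apply differentiableAt_fst differentiableAt_snd]
  have h2 : mvfderiv (𝓡 n) (fun y => (A y, f y)) x v =
      (mvfderiv (𝓡 n) A x v, mvfderiv (𝓡 n) f x v) := by
    have h3 := mvfderiv_fderiv_comp (n := n) (φ := fun q : (F →L[ℝ] G) × F => q.1)
      (f := fun y => (A y, f y)) (x := x) differentiableAt_fst (hA.prodMk_space hf) v
    have h4 := mvfderiv_fderiv_comp (n := n) (φ := fun q : (F →L[ℝ] G) × F => q.2)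
      (f := fun y => (A y, f y)) (x := x) differentiableAt_snd (hA.prodMk_space hf) v
    simp only [fderiv_fst, fderiv_snd] at h3 h4
    exact Prod.ext h3.symm h4.symm
  rw [h2]
  simp [fderiv_fst, fderiv_snd, add_comm]

variable [IsManifold (𝓡 n) ∞ B]

/-- A vector field in the chart at `x₀`. -/
def chartField (X : ∀ x : B, TangentSpace (𝓡 n) x) (x₀ : B) (z : EuclideanSpace ℝ (Fin n)) :
    EuclideanSpace ℝ (Fin n) :=
  mvfderiv (𝓡 n) (extChartAt (𝓡 n) x₀) ((extChartAt (𝓡 n) x₀).symm z)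
    (X ((extChartAt (𝓡 n) x₀).symm z))

theorem chartField_apply (X : ∀ x : B, TangentSpace (𝓡 n) x) {x₀ x : B}
    (hx : x ∈ (extChartAt (𝓡 n) x₀).source) :
    chartField X x₀ (extChartAt (𝓡 n) x₀ x) = mvfderiv (𝓡 n) (extChartAt (𝓡 n) x₀) x (X x) := by
  simp only [chartField]
  rw [(extChartAt (𝓡 n) x₀).left_inv hx]

/-- `mlieBracket` is defined by pulling fields back along the inverse chart; since the differentials
of the chart and its inverse are mutually inverse, this pullback is the push-forward by the chart.
-/
theorem chartField_eq_mpullbackWithin (X : ∀ x : B, TangentSpace (𝓡 n) x) {x₀ : B}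
    {z : EuclideanSpace ℝ (Fin n)} (hz : z ∈ (extChartAt (𝓡 n) x₀).target) :
    mpullbackWithin 𝓘(ℝ, EuclideanSpace ℝ (Fin n)) (𝓡 n) (extChartAt (𝓡 n) x₀).symm X
      (Set.range (𝓡 n)) z = chartField X x₀ z := by
  rw [mpullbackWithin_apply]
  have h1 := mfderiv_extChartAt_comp_mfderivWithin_extChartAt_symm (I := 𝓡 n) hz
  have h2 := mfderivWithin_extChartAt_symm_comp_mfderiv_extChartAt (I := 𝓡 n) hz
  rw [ContinuousLinearMap.inverse_eq h2 h1]
  rfl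

theorem chartField_differentiableAt {X : ∀ x : B, TangentSpace (𝓡 n) x} {x₀ : B}
    (hX : MDifferentiableAt (𝓡 n) (𝓡 n).tangent
      (fun y => (⟨y, X y⟩ : TangentBundle (𝓡 n) B)) x₀) :
    DifferentiableAt ℝ (chartField X x₀) (extChartAt (𝓡 n) x₀ x₀) := by
  have h := MDifferentiableWithinAt.differentiableWithinAt_mpullbackWithin_vectorField
    (I := 𝓡 n) (s := Set.univ) (V := X) (x := x₀) hX.mdifferentiableWithinAt
  simp only [Set.preimage_univ, Set.univ_inter, ModelWithCorners.range_eq_univ] at h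
  refine DifferentiableAt.congr_of_eventuallyEq (differentiableWithinAt_univ.1 h) ?_
  filter_upwards [extChartAt_target_mem_nhds (I := 𝓡 n) x₀] with z hz
  rw [← chartField_eq_mpullbackWithin X hz, ModelWithCorners.range_eq_univ]

/-- The manifold bracket is the inverse of the chart's differential applied to the bracket in the
chart, so applying the differential cancels the inverse. -/
theorem mvfderiv_extChartAt_mlieBracket (X Y : ∀ x : B, TangentSpace (𝓡 n) x) (x₀ : B) :
    mvfderiv (𝓡 n) (extChartAt (𝓡 n) x₀) x₀ (mlieBracket (𝓡 n) X Y x₀) =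
      lieBracket ℝ (chartField X x₀) (chartField Y x₀) (extChartAt (𝓡 n) x₀ x₀) := by
  rw [mlieBracket, mlieBracketWithin_apply]
  have hinv := isInvertible_mfderiv_extChartAt (I := 𝓡 n) (mem_extChartAt_source (I := 𝓡 n) x₀)
  refine (hinv.self_apply_inverse _).trans ?_
  simp only [Set.preimage_univ, Set.univ_inter, ModelWithCorners.range_eq_univ]
  refine (congrFun (lieBracketWithin_univ (𝕜 := ℝ) (E := EuclideanSpace ℝ (Fin n))) _).trans ?_
  refine Filter.EventuallyEq.lieBracket_vectorField_eq ?_ ?_ <;>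
  · filter_upwards [extChartAt_target_mem_nhds (I := 𝓡 n) x₀] with z hz
    rw [← chartField_eq_mpullbackWithin _ hz, ModelWithCorners.range_eq_univ]

/-- `[X, Y] f = X (Y f) - Y (X f)` for a vector valued function `f`. -/
theorem mvfderiv_mlieBracket {f : B → F} {x₀ : B}
    (hf : ContMDiffAt (𝓡 n) 𝓘(ℝ, F) ∞ f x₀) {X Y : ∀ x : B, TangentSpace (𝓡 n) x}
    (hX : MDifferentiableAt (𝓡 n) (𝓡 n).tangent
      (fun y => (⟨y, X y⟩ : TangentBundle (𝓡 n) B)) x₀)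
    (hY : MDifferentiableAt (𝓡 n) (𝓡 n).tangent
      (fun y => (⟨y, Y y⟩ : TangentBundle (𝓡 n) B)) x₀) :
    mvfderiv (𝓡 n) f x₀ (mlieBracket (𝓡 n) X Y x₀) =
      mvfderiv (𝓡 n) (fun x => mvfderiv (𝓡 n) f x (Y x)) x₀ (X x₀) -
        mvfderiv (𝓡 n) (fun x => mvfderiv (𝓡 n) f x (X x)) x₀ (Y x₀) := by
  set ψ := extChartAt (𝓡 n) x₀ with hψ
  set f' : EuclideanSpace ℝ (Fin n) → F := fun z => f (ψ.symm z) with hf'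
  have hf'_smooth : ContDiffAt ℝ ∞ f' (ψ x₀) := by
    have h1 : ContMDiffAt 𝓘(ℝ, EuclideanSpace ℝ (Fin n)) (𝓡 n) ∞ ψ.symm (ψ x₀) :=
      (contMDiffOn_extChartAt_symm x₀).contMDiffAt (extChartAt_target_mem_nhds x₀)
    have h2 : ContMDiffAt (𝓡 n) 𝓘(ℝ, F) ∞ f (ψ.symm (ψ x₀)) := by
      rwa [extChartAt_to_inv]
    exact (h2.comp _ h1).contDiffAt
  have hψ_diff : ∀ᶠ x in 𝓝 x₀, MDifferentiableAt (𝓡 n) 𝓘(ℝ, EuclideanSpace ℝ (Fin n)) ψ x := by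
    filter_upwards [(chartAt (EuclideanSpace ℝ (Fin n)) x₀).open_source.mem_nhds
      (mem_chart_source _ x₀)] with x hx
    exact mdifferentiableAt_extChartAt hx
  have hψ_cont : ContinuousAt ψ x₀ := continuousAt_extChartAt x₀
  have hff' : ∀ᶠ x in 𝓝 x₀, f x = f' (ψ x) := by
    filter_upwards [extChartAt_source_mem_nhds (I := 𝓡 n) x₀] with x hx
    rw [hf']
    exact congrArg f (ψ.left_inv hx).symm
  have hf'_diff : ∀ᶠ x in 𝓝 x₀, DifferentiableAt ℝ f' (ψ x) := by
    have : ∀ᶠ z in 𝓝 (ψ x₀), ContDiffAt ℝ 1 f' z :=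
      (hf'_smooth.of_le (by simp)).eventually (by simp)
    filter_upwards [hψ_cont.eventually this] with x hx
    exact hx.differentiableAt one_ne_zero
  have hder : ∀ᶠ x in 𝓝 x₀, ∀ v : TangentSpace (𝓡 n) x,
      mvfderiv (𝓡 n) f x v = fderiv ℝ f' (ψ x) (mvfderiv (𝓡 n) ψ x v) := by
    filter_upwards [hff'.eventually_nhds, hψ_diff, hf'_diff] with x h1 h2 h3 v
    rw [mvfderiv_congr h1, mvfderiv_fderiv_comp h3 h2]
  have hfield : ∀ Z : (∀ x : B, TangentSpace (𝓡 n) x),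
      (fun x => mvfderiv (𝓡 n) f x (Z x)) =ᶠ[𝓝 x₀]
        fun x => (fun z => fderiv ℝ f' z (chartField Z x₀ z)) (ψ x) := by
    intro Z
    filter_upwards [hder, extChartAt_source_mem_nhds (I := 𝓡 n) x₀] with x h1 h2
    rw [h1, ← chartField_apply Z h2]
  have hf'2 : DifferentiableAt ℝ (fderiv ℝ f') (ψ x₀) :=
    (hf'_smooth.fderiv_right (m := 1) (by rw [one_add_one_eq_two]; exact ENat.LEInfty.out)).differentiableAt one_ne_zero
  -- An iterated derivative splits into a derivative of the field and a second derivative of `f'`.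
  -- In the commutator the second-order terms cancel by symmetry, and the first-order terms form the
  -- bracket in the chart.
  have hsecond : ∀ Z : (∀ x : B, TangentSpace (𝓡 n) x),
      MDifferentiableAt (𝓡 n) (𝓡 n).tangent
        (fun y => (⟨y, Z y⟩ : TangentBundle (𝓡 n) B)) x₀ → ∀ v : TangentSpace (𝓡 n) x₀,
      mvfderiv (𝓡 n) (fun x => mvfderiv (𝓡 n) f x (Z x)) x₀ v =
        fderiv ℝ f' (ψ x₀) (fderiv ℝ (chartField Z x₀) (ψ x₀) (mvfderiv (𝓡 n) ψ x₀ v)) +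
          fderiv ℝ (fderiv ℝ f') (ψ x₀) (mvfderiv (𝓡 n) ψ x₀ v) (chartField Z x₀ (ψ x₀)) := by
    intro Z hZ v
    have hZ' := chartField_differentiableAt hZ
    rw [mvfderiv_congr (hfield Z), mvfderiv_fderiv_comp (hf'2.clm_apply hZ') hψ_diff.self_of_nhds,
      fderiv_clm_apply hf'2 hZ']
    rfl
  have hsymm : IsSymmSndFDerivAt ℝ f' (ψ x₀) :=
    hf'_smooth.isSymmSndFDerivAt (by
      rw [minSmoothness_of_isRCLikeNormedField]; exact ENat.LEInfty.out)
  rw [hder.self_of_nhds, mvfderiv_extChartAt_mlieBracket, hsecond Y hY, hsecond X hX,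
    ← chartField_apply X (mem_extChartAt_source x₀), ← chartField_apply Y (mem_extChartAt_source x₀),
    lieBracket, map_sub, hsymm.eq]
  abel

end Calculus

/-! ### Connections in the coordinates of a chart. -/

section Connection

open VectorField

variable {N : ℕ} {B : Type*} [TopologicalSpace B]
    [ChartedSpace (EuclideanSpace ℝ (Fin N)) B] [IsManifold (𝓡 N) ∞ B]

/-- The coordinates of the tangent vector `v` in the chart at `x₀`. -/
abbrev tangentCoord (x₀ : B) {x : B} (v : TangentSpace (𝓡 N) x) : EuclideanSpace ℝ (Fin N) :=
  (trivializationAt (EuclideanSpace ℝ (Fin N)) (TangentSpace (𝓡 N) : B → Type _) x₀ ⟨x, v⟩).2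

/-- The tangent vector at `x` with given coordinates in the chart at `x₀`. -/
abbrev tangentOfCoord (x₀ x : B) (w : EuclideanSpace ℝ (Fin N)) : TangentSpace (𝓡 N) x :=
  (trivializationAt (EuclideanSpace ℝ (Fin N)) (TangentSpace (𝓡 N) : B → Type _) x₀).symm x w

theorem mem_baseSet_nhds (x₀ : B) : (trivializationAt (EuclideanSpace ℝ (Fin N))
    (TangentSpace (𝓡 N) : B → Type _) x₀).baseSet ∈ 𝓝 x₀ :=
  (trivializationAt _ _ x₀).open_baseSet.mem_nhds (FiberBundle.mem_baseSet_trivializationAt' x₀)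

theorem tangentCoord_eq_clm {x₀ x : B} (hx : x ∈ (trivializationAt (EuclideanSpace ℝ (Fin N))
    (TangentSpace (𝓡 N) : B → Type _) x₀).baseSet) (v : TangentSpace (𝓡 N) x) :
    tangentCoord x₀ v = (trivializationAt (EuclideanSpace ℝ (Fin N))
      (TangentSpace (𝓡 N) : B → Type _) x₀).continuousLinearMapAt ℝ x v := by
  rw [Bundle.Trivialization.continuousLinearMapAt_apply,
    Bundle.Trivialization.linearMapAt_apply, if_pos hx]

theorem tangentCoord_eq_mvfderiv {x₀ x : B} (hx : x ∈ (trivializationAt (EuclideanSpace ℝ (Fin N))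
    (TangentSpace (𝓡 N) : B → Type _) x₀).baseSet) (v : TangentSpace (𝓡 N) x) :
    tangentCoord x₀ v = mvfderiv (𝓡 N) (extChartAt (𝓡 N) x₀) x v := by
  rw [tangentCoord_eq_clm hx, TangentBundle.continuousLinearMapAt_trivializationAt hx]
  rfl

theorem tangentCoord_tangentOfCoord {x₀ x : B} (hx : x ∈ (trivializationAt
    (EuclideanSpace ℝ (Fin N)) (TangentSpace (𝓡 N) : B → Type _) x₀).baseSet)
    (w : EuclideanSpace ℝ (Fin N)) : tangentCoord x₀ (tangentOfCoord x₀ x w) = w := by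
  exact congrArg Prod.snd (Bundle.Trivialization.apply_mk_symm _ hx w)

theorem tangentOfCoord_tangentCoord {x₀ x : B} (hx : x ∈ (trivializationAt
    (EuclideanSpace ℝ (Fin N)) (TangentSpace (𝓡 N) : B → Type _) x₀).baseSet)
    (v : TangentSpace (𝓡 N) x) : tangentOfCoord x₀ x (tangentCoord x₀ v) = v := by
  exact Bundle.Trivialization.symm_apply_apply_mk _ hx v

theorem tangentOfCoord_eq_symmL {x₀ x : B} (hx : x ∈ (trivializationAt
    (EuclideanSpace ℝ (Fin N)) (TangentSpace (𝓡 N) : B → Type _) x₀).baseSet)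
    (w : EuclideanSpace ℝ (Fin N)) : tangentOfCoord x₀ x w = (trivializationAt
    (EuclideanSpace ℝ (Fin N)) (TangentSpace (𝓡 N) : B → Type _) x₀).symmL ℝ x w :=
  (Bundle.Trivialization.symmL_apply _ hx w).symm

theorem tangentCoord_extend {x₀ : B} (v : TangentSpace (𝓡 N) x₀) :
    ∀ᶠ x in 𝓝 x₀, tangentCoord x₀
      (FiberBundle.extend (EuclideanSpace ℝ (Fin N)) v x) = tangentCoord x₀ v := by
  filter_upwards [mem_baseSet_nhds (N := N) x₀] with x hx
  exact tangentCoord_tangentOfCoord hx _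

/-- The flat covariant derivative of the chart at `x₀`. -/
def flatDerivative (x₀ : B) (σ : ∀ x : B, TangentSpace (𝓡 N) x) (x : B) :
    TangentSpace (𝓡 N) x →L[ℝ] TangentSpace (𝓡 N) x :=
  ((trivializationAt (EuclideanSpace ℝ (Fin N)) (TangentSpace (𝓡 N) : B → Type _) x₀).symmL ℝ x).comp
    (mvfderiv (𝓡 N) (fun y => tangentCoord x₀ (σ y)) x)

/-- The flat derivative serves as a reference connection to compare with `cov`. The comparison takes
place only at the centre of the chart, so one point suffices. -/
theorem isCovariantDerivativeOn_flatDerivative (x₀ : B) :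
    IsCovariantDerivativeOn (EuclideanSpace ℝ (Fin N)) (flatDerivative (N := N) x₀) {x₀} where
  add {σ σ' x} hσ hσ' hx := by
    obtain rfl : x = x₀ := hx
    rw [mdifferentiableAt_section] at hσ hσ'
    have h : (fun y => tangentCoord x ((σ + σ') y)) =ᶠ[𝓝 x]
        (fun y => tangentCoord x (σ y)) + fun y => tangentCoord x (σ' y) := by
      filter_upwards [mem_baseSet_nhds (N := N) x] with y hy
      simp only [Pi.add_apply, tangentCoord_eq_clm hy, map_add]
    rw [flatDerivative, mvfderiv_congr h, mvfderiv_add hσ hσ', ContinuousLinearMap.comp_add]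
    rfl
  leibniz {σ g x} hσ hg hx := by
    obtain rfl : x = x₀ := hx
    have hb := FiberBundle.mem_baseSet_trivializationAt' (F := EuclideanSpace ℝ (Fin N))
      (E := (TangentSpace (𝓡 N) : B → Type _)) x
    rw [mdifferentiableAt_section] at hσ
    have h : (fun y => tangentCoord x ((g • σ) y)) =ᶠ[𝓝 x]
        g • fun y => tangentCoord x (σ y) := by
      filter_upwards [mem_baseSet_nhds (N := N) x] with y hy
      simp only [Pi.smul_apply', tangentCoord_eq_clm hy, map_smul]
    rw [flatDerivative, mvfderiv_congr h, mvfderiv_smul hg hσ]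
    ext1 v
    have := tangentOfCoord_tangentCoord hb (σ x)
    rw [tangentOfCoord_eq_symmL hb] at this
    simp [flatDerivative, this]

/-- A connection in coordinates: the derivative of the components plus the derivative of the
field with constant components. -/
theorem cov_eq_add_extend (cov : CovariantDerivative (𝓡 N) (EuclideanSpace ℝ (Fin N))
      (TangentSpace (𝓡 N) : B → Type _)) {σ : ∀ x : B, TangentSpace (𝓡 N) x} {x : B}
    (hσ : MDifferentiableAt (𝓡 N) (𝓡 N).tangent
      (fun y => (⟨y, σ y⟩ : TangentBundle (𝓡 N) B)) x) (u : TangentSpace (𝓡 N) x) :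
    cov σ x u = tangentOfCoord x x (mvfderiv (𝓡 N) (fun y => tangentCoord x (σ y)) x u) +
      cov (FiberBundle.extend (EuclideanSpace ℝ (Fin N)) (σ x)) x u := by
  have hcov := cov.isCovariantDerivativeOn (s := {x})
  have hflat := isCovariantDerivativeOn_flatDerivative (N := N) x
  -- The difference of two connections is tensorial, so it is the same for `σ` and for the extension
  -- of `σ x`. The extension has constant components, so its flat derivative vanishes.
  have h1 := IsCovariantDerivativeOn.difference_apply hcov hflat (Set.mem_singleton x) hσ
  have h2 := IsCovariantDerivativeOn.difference_apply hcov hflat (Set.mem_singleton x)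
    (FiberBundle.mdifferentiableAt_extend (𝓡 N) (EuclideanSpace ℝ (Fin N)) (σ x))
  rw [FiberBundle.extend_apply_self, h1] at h2
  have h3 : flatDerivative x (FiberBundle.extend (EuclideanSpace ℝ (Fin N)) (σ x)) x = 0 := by
    rw [flatDerivative, mvfderiv_congr (tangentCoord_extend (σ x)), mvfderiv_const,
      ContinuousLinearMap.comp_zero]
  rw [h3, sub_zero] at h2
  rw [tangentOfCoord_eq_symmL (FiberBundle.mem_baseSet_trivializationAt' x), ← h2]
  simp [flatDerivative]

/-- Both fields have constant components in the chart at `x`, so the commutator formula applied to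
the chart itself differentiates only locally constant functions. -/
theorem mlieBracket_extend_eq_zero {x : B} (u v : TangentSpace (𝓡 N) x) :
    mlieBracket (𝓡 N) (FiberBundle.extend (EuclideanSpace ℝ (Fin N)) u)
      (FiberBundle.extend (EuclideanSpace ℝ (Fin N)) v) x = 0 := by
  have hinv := isInvertible_mfderiv_extChartAt (I := 𝓡 N) (mem_extChartAt_source (I := 𝓡 N) x)
  refine hinv.injective ?_
  rw [map_zero]
  have hconst : ∀ w : TangentSpace (𝓡 N) x,
      (fun y => mvfderiv (𝓡 N) (extChartAt (𝓡 N) x) y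
        (FiberBundle.extend (EuclideanSpace ℝ (Fin N)) w y)) =ᶠ[𝓝 x]
      fun _ => tangentCoord x w := by
    intro w
    filter_upwards [tangentCoord_extend w, mem_baseSet_nhds (N := N) x] with y h1 h2
    rw [← h1, tangentCoord_eq_mvfderiv h2]
  refine (mvfderiv_mlieBracket (contMDiffAt_extChartAt (I := 𝓡 N) (n := ∞))
    (FiberBundle.mdifferentiableAt_extend (𝓡 N) (EuclideanSpace ℝ (Fin N)) u)
    (FiberBundle.mdifferentiableAt_extend (𝓡 N) (EuclideanSpace ℝ (Fin N)) v)).trans ?_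
  rw [mvfderiv_congr (hconst u), mvfderiv_congr (hconst v), mvfderiv_const, mvfderiv_const]
  exact sub_self _

end Connection

/-! ### The connection along a map, and smoothness of tangent fields of an immersion. -/

section AlongImmersion

open VectorField

variable {m N : ℕ} {M : Type*} [TopologicalSpace M]
    [ChartedSpace (EuclideanSpace ℝ (Fin m)) M] [IsManifold (𝓡 m) ∞ M]
    {Mbar : Type*} [TopologicalSpace Mbar]
    [ChartedSpace (EuclideanSpace ℝ (Fin N)) Mbar] [IsManifold (𝓡 N) ∞ Mbar]

/-- A field of endomorphisms of the tangent spaces in the coordinates at `x₀`. -/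
abbrev endCoord (A : ∀ x : Mbar, TangentSpace (𝓡 N) x →L[ℝ] TangentSpace (𝓡 N) x) (x₀ x : Mbar) :
    EuclideanSpace ℝ (Fin N) →L[ℝ] EuclideanSpace ℝ (Fin N) :=
  ContinuousLinearMap.inCoordinates (EuclideanSpace ℝ (Fin N)) (TangentSpace (𝓡 N) : Mbar → Type _)
    (EuclideanSpace ℝ (Fin N)) (TangentSpace (𝓡 N) : Mbar → Type _) x₀ x x₀ x (A x)

theorem endCoord_tangentCoord
    (A : ∀ x : Mbar, TangentSpace (𝓡 N) x →L[ℝ] TangentSpace (𝓡 N) x) {x₀ x : Mbar}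
    (hx : x ∈ (trivializationAt (EuclideanSpace ℝ (Fin N))
      (TangentSpace (𝓡 N) : Mbar → Type _) x₀).baseSet) (v : TangentSpace (𝓡 N) x) :
    endCoord A x₀ x (tangentCoord x₀ v) = tangentCoord x₀ (A x v) := by
  have h := tangentOfCoord_tangentCoord hx v
  rw [tangentOfCoord_eq_symmL hx] at h
  rw [tangentCoord_eq_clm hx (A x v)]
  conv_rhs => rw [← h]
  rfl

theorem tangentOfCoord_endCoord
    (A : ∀ x : Mbar, TangentSpace (𝓡 N) x →L[ℝ] TangentSpace (𝓡 N) x) {x₀ x : Mbar}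
    (hx : x ∈ (trivializationAt (EuclideanSpace ℝ (Fin N))
      (TangentSpace (𝓡 N) : Mbar → Type _) x₀).baseSet) (w : EuclideanSpace ℝ (Fin N)) :
    tangentOfCoord x₀ x (endCoord A x₀ x w) = A x (tangentOfCoord x₀ x w) := by
  conv_lhs => rw [← tangentCoord_tangentOfCoord hx w]
  rw [endCoord_tangentCoord A hx, tangentOfCoord_tangentCoord hx]

theorem tangentOfCoord_add {x₀ x : Mbar} (hx : x ∈ (trivializationAt (EuclideanSpace ℝ (Fin N))
    (TangentSpace (𝓡 N) : Mbar → Type _) x₀).baseSet) (w w' : EuclideanSpace ℝ (Fin N)) :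
    tangentOfCoord x₀ x (w + w') = tangentOfCoord x₀ x w + tangentOfCoord x₀ x w' := by
  simp only [tangentOfCoord_eq_symmL hx, map_add]

/-- A parallel endomorphism field commutes with differentiation along a map. -/
theorem covAlong_parallel (cov : CovariantDerivative (𝓡 N) (EuclideanSpace ℝ (Fin N))
      (TangentSpace (𝓡 N) : Mbar → Type _))
    (A : ∀ x : Mbar, TangentSpace (𝓡 N) x →L[ℝ] TangentSpace (𝓡 N) x)
    (hA : ContMDiff (𝓡 N)
      ((𝓡 N).prod 𝓘(ℝ, EuclideanSpace ℝ (Fin N) →L[ℝ] EuclideanSpace ℝ (Fin N))) ∞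
      (fun x => Bundle.TotalSpace.mk' (EuclideanSpace ℝ (Fin N) →L[ℝ] EuclideanSpace ℝ (Fin N))
        (E := fun x : Mbar => TangentSpace (𝓡 N) x →L[ℝ] TangentSpace (𝓡 N) x) x (A x)))
    (hpar : ∀ (σ : ∀ x : Mbar, TangentSpace (𝓡 N) x) (x : Mbar),
      MDifferentiableAt (𝓡 N) (𝓡 N).tangent
        (fun y => (⟨y, σ y⟩ : TangentBundle (𝓡 N) Mbar)) x →
      ∀ v : TangentSpace (𝓡 N) x, cov (fun y => A y (σ y)) x v = A x (cov σ x v))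
    {ι : M → Mbar} {V : ∀ p : M, TangentSpace (𝓡 N) (ι p)} {p : M}
    (hV : MDifferentiableAt (𝓡 m) (𝓡 N).tangent
      (fun q => (⟨ι q, V q⟩ : TangentBundle (𝓡 N) Mbar)) p) (v : TangentSpace (𝓡 m) p) :
    covAlong cov ι (fun q => A (ι q) (V q)) p v = A (ι p) (covAlong cov ι V p v) := by
  have hb := FiberBundle.mem_baseSet_trivializationAt' (F := EuclideanSpace ℝ (Fin N))
    (E := (TangentSpace (𝓡 N) : Mbar → Type _)) (ι p)
  obtain ⟨hι, hV'⟩ := (mdifferentiableAt_totalSpace (𝓡 N) _).1 hV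
  have hι : MDifferentiableAt (𝓡 m) (𝓡 N) ι p := hι
  have hV' : MDifferentiableAt (𝓡 m) 𝓘(ℝ, EuclideanSpace ℝ (Fin N))
    (fun q => tangentCoord (ι p) (V q)) p := hV'
  have hAc : MDifferentiableAt (𝓡 N)
      𝓘(ℝ, EuclideanSpace ℝ (Fin N) →L[ℝ] EuclideanSpace ℝ (Fin N)) (endCoord A (ι p)) (ι p) :=
    ((contMDiffAt_hom_bundle _).1 (hA (ι p))).2.mdifferentiableAt (by simp)
  set u := mfderiv (𝓡 m) (𝓡 N) ι p v with hu
  set w := tangentCoord (ι p) (V p) with hw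
  -- The product rule produces a term with the derivative of the matrix of `A`. Parallelism is
  -- available only for fields on `Mbar`; applied to the constant-component extension of `V p`, it
  -- yields the same matrix term (`h2`, `h3`), which accounts for it.
  have h1 : mvfderiv (𝓡 m) (fun q => tangentCoord (ι p) (A (ι q) (V q))) p v =
      mvfderiv (𝓡 N) (endCoord A (ι p)) (ι p) u w +
        endCoord A (ι p) (ι p) (mvfderiv (𝓡 m) (fun q => tangentCoord (ι p) (V q)) p v) := by
    have : (fun q => tangentCoord (ι p) (A (ι q) (V q))) =ᶠ[𝓝 p]
        fun q => endCoord A (ι p) (ι q) (tangentCoord (ι p) (V q)) := by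
      filter_upwards [hι.continuousAt.eventually (mem_baseSet_nhds (N := N) (ι p))] with q hq
      exact (endCoord_tangentCoord A hq _).symm
    rw [mvfderiv_congr this, mvfderiv_clm_apply (A := fun q => endCoord A (ι p) (ι q))
      (hAc.comp p hι) hV', mvfderiv_comp_mfderiv hAc hι]
  set e := FiberBundle.extend (EuclideanSpace ℝ (Fin N)) (V p) with he
  have hed := FiberBundle.mdifferentiableAt_extend (𝓡 N) (EuclideanSpace ℝ (Fin N)) (V p)
  have hAed : MDifferentiableAt (𝓡 N) (𝓡 N).tangent
      (fun y => (⟨y, A y (e y)⟩ : TangentBundle (𝓡 N) Mbar)) (ι p) :=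
    ((hA (ι p)).mdifferentiableAt (by simp)).clm_bundle_apply hed
  have h2 : mvfderiv (𝓡 N) (fun y => tangentCoord (ι p) (A y (e y))) (ι p) u =
      mvfderiv (𝓡 N) (endCoord A (ι p)) (ι p) u w := by
    have : (fun y => tangentCoord (ι p) (A y (e y))) =ᶠ[𝓝 (ι p)]
        fun y => endCoord A (ι p) y w := by
      filter_upwards [mem_baseSet_nhds (N := N) (ι p), tangentCoord_extend (V p)] with y hy hy'
      rw [← endCoord_tangentCoord A hy, hy']
    rw [mvfderiv_congr this, mvfderiv_clm_apply hAc mdifferentiableAt_const, mvfderiv_const]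
    simp
  have h3 := cov_eq_add_extend cov hAed u
  rw [hpar e (ι p) hed u, h2] at h3
  have h4 : e (ι p) = V p := FiberBundle.extend_apply_self _ _
  rw [h4] at h3
  change tangentOfCoord (ι p) (ι p)
      (mvfderiv (𝓡 m) (fun q => tangentCoord (ι p) (A (ι q) (V q))) p v) +
      cov (FiberBundle.extend (EuclideanSpace ℝ (Fin N)) (A (ι p) (V p))) (ι p) u =
    A (ι p) (tangentOfCoord (ι p) (ι p) (mvfderiv (𝓡 m) (fun q => tangentCoord (ι p) (V q)) p v) +
      cov e (ι p) u)
  rw [h1, tangentOfCoord_add hb, tangentOfCoord_endCoord A hb, map_add, h3]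
  abel

/-- The connection along a map is torsion free:
`∇bar_X Y - ∇bar_Y X` is the image of `[X, Y]`. -/
theorem nablaBar_sub_nablaBar {cov : CovariantDerivative (𝓡 N) (EuclideanSpace ℝ (Fin N))
      (TangentSpace (𝓡 N) : Mbar → Type _)} (hcov : cov.torsion = 0) {ι : M → Mbar}
    (hι : ContMDiff (𝓡 m) (𝓡 N) ∞ ι) {X Y : ∀ p : M, TangentSpace (𝓡 m) p} {p : M}
    (hX : MDifferentiableAt (𝓡 m) (𝓡 m).tangent
      (fun y => (⟨y, X y⟩ : TangentBundle (𝓡 m) M)) p)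
    (hY : MDifferentiableAt (𝓡 m) (𝓡 m).tangent
      (fun y => (⟨y, Y y⟩ : TangentBundle (𝓡 m) M)) p) :
    nablaBar cov ι X Y p - nablaBar cov ι Y X p =
      mfderiv (𝓡 m) (𝓡 N) ι p (mlieBracket (𝓡 m) X Y p) := by
  have hb := FiberBundle.mem_baseSet_trivializationAt' (F := EuclideanSpace ℝ (Fin N))
    (E := (TangentSpace (𝓡 N) : Mbar → Type _)) (ι p)
  set φ := extChartAt (𝓡 N) (ι p) with hφ
  have hιd : ∀ q, MDifferentiableAt (𝓡 m) (𝓡 N) ι q := fun q => (hι q).mdifferentiableAt (by simp)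
  -- The components of the image of `Z` are the derivatives of `φ ∘ ι` along `Z`, so the commutator
  -- formula for `φ ∘ ι` handles the component part of `∇bar`.
  have hcoord : ∀ Z : (∀ p : M, TangentSpace (𝓡 m) p),
      (fun q => tangentCoord (ι p) (mfderiv (𝓡 m) (𝓡 N) ι q (Z q))) =ᶠ[𝓝 p]
        fun q => mvfderiv (𝓡 m) (fun r => φ (ι r)) q (Z q) := by
    intro Z
    filter_upwards [(hιd p).continuousAt.eventually (mem_baseSet_nhds (N := N) (ι p))] with q hq
    rw [tangentCoord_eq_mvfderiv hq, mvfderiv_comp_mfderiv (mdifferentiableAt_extChartAt hq) (hιd q)]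
  have hbr := mvfderiv_mlieBracket (f := fun r => φ (ι r))
    ((contMDiffAt_extChartAt (I := 𝓡 N) (n := ∞)).comp p (hι p)) hX hY
  rw [← mvfderiv_congr (hcoord X), ← mvfderiv_congr (hcoord Y),
    mvfderiv_comp_mfderiv (mdifferentiableAt_extChartAt hb) (hιd p),
    ← tangentCoord_eq_mvfderiv hb] at hbr
  -- The two extensions commute at `ι p`, so zero torsion makes the remaining connection terms
  -- symmetric in `X` and `Y`, and they cancel.
  have htor := (CovariantDerivative.torsion_eq_zero_iff cov).1 hcov
    (FiberBundle.mdifferentiableAt_extend (𝓡 N) (EuclideanSpace ℝ (Fin N))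
      (mfderiv (𝓡 m) (𝓡 N) ι p (X p)))
    (FiberBundle.mdifferentiableAt_extend (𝓡 N) (EuclideanSpace ℝ (Fin N))
      (mfderiv (𝓡 m) (𝓡 N) ι p (Y p)))
  rw [mlieBracket_extend_eq_zero, FiberBundle.extend_apply_self,
    FiberBundle.extend_apply_self, sub_eq_zero] at htor
  rw [← tangentOfCoord_tangentCoord hb (mfderiv (𝓡 m) (𝓡 N) ι p (mlieBracket (𝓡 m) X Y p)), hbr]
  change (tangentOfCoord (ι p) (ι p) _ + _) - (tangentOfCoord (ι p) (ι p) _ + _) = _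
  rw [htor, add_sub_add_right_eq_sub, tangentOfCoord_eq_symmL hb, tangentOfCoord_eq_symmL hb,
    tangentOfCoord_eq_symmL hb, ← map_sub]

/-- A vector field on `M` is smooth if its image under the differential of an immersion is. -/
theorem contMDiff_of_mfderiv {ι : M → Mbar} (hι : IsSubmanifold m (N := N) ι)
    {W : ∀ p : M, TangentSpace (𝓡 m) p}
    (hW : ContMDiff (𝓡 m) (𝓡 N).tangent ∞
      (fun p => (⟨ι p, mfderiv (𝓡 m) (𝓡 N) ι p (W p)⟩ : TangentBundle (𝓡 N) Mbar))) :
    ContMDiff (𝓡 m) (𝓡 m).tangent ∞ (fun p => (⟨p, W p⟩ : TangentBundle (𝓡 m) M)) := by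
  intro p
  have hbm := FiberBundle.mem_baseSet_trivializationAt' (F := EuclideanSpace ℝ (Fin m))
    (E := (TangentSpace (𝓡 m) : M → Type _)) p
  have hb := FiberBundle.mem_baseSet_trivializationAt' (F := EuclideanSpace ℝ (Fin N))
    (E := (TangentSpace (𝓡 N) : Mbar → Type _)) (ι p)
  refine Bundle.contMDiffAt_totalSpace.2 ⟨contMDiffAt_id, ?_⟩
  change ContMDiffAt (𝓡 m) 𝓘(ℝ, EuclideanSpace ℝ (Fin m)) ∞ (fun q => tangentCoord p (W q)) p
  have hV : ContMDiffAt (𝓡 m) 𝓘(ℝ, EuclideanSpace ℝ (Fin N)) ∞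
      (fun q => tangentCoord (ι p) (mfderiv (𝓡 m) (𝓡 N) ι q (W q))) p :=
    (Bundle.contMDiffAt_totalSpace.1 (hW p)).2
  set A := inTangentCoordinates (𝓡 m) (𝓡 N) id ι (mfderiv (𝓡 m) (𝓡 N) ι) p with hA
  have hAs : ContMDiffAt (𝓡 m) 𝓘(ℝ, EuclideanSpace ℝ (Fin m) →L[ℝ] EuclideanSpace ℝ (Fin N)) ∞
      A p := (hι.contMDiff p).mfderiv_const (by simp)
  have hAapp : ∀ q, q ∈ (trivializationAt (EuclideanSpace ℝ (Fin m))
      (TangentSpace (𝓡 m) : M → Type _) p).baseSet → ι q ∈ (trivializationAt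
      (EuclideanSpace ℝ (Fin N)) (TangentSpace (𝓡 N) : Mbar → Type _) (ι p)).baseSet →
      ∀ v : TangentSpace (𝓡 m) q,
        A q (tangentCoord p v) = tangentCoord (ι p) (mfderiv (𝓡 m) (𝓡 N) ι q v) := by
    intro q hq hq' v
    have h := tangentOfCoord_tangentCoord hq v
    rw [tangentOfCoord_eq_symmL hq] at h
    rw [tangentCoord_eq_clm hq']
    conv_rhs => rw [← h]
    rfl
  have hAinj : Function.Injective (A p) := by
    intro w w' h
    rw [← tangentCoord_tangentOfCoord hbm w, ← tangentCoord_tangentOfCoord hbm w',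
      hAapp p hbm hb, hAapp p hbm hb] at h
    have h' := congrArg (tangentOfCoord (ι p) (ι p)) h
    rw [tangentOfCoord_tangentCoord hb, tangentOfCoord_tangentCoord hb] at h'
    have h'' := congrArg (tangentCoord p) (hι.injective_mfderiv p h')
    rwa [tangentCoord_tangentOfCoord hbm, tangentCoord_tangentOfCoord hbm] at h''
  -- A left inverse `C` of the differential at `p` stays usable nearby: `C ∘ A q` is the identity at
  -- `q = p`, hence invertible for `q` near `p`, and `(C ∘ A q)⁻¹ ∘ C` recovers the components of
  -- `W` smoothly from those of its image.
  obtain ⟨C, hC⟩ := LinearMap.exists_leftInverse_of_injective (A p).toLinearMap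
    (LinearMap.ker_eq_bot.2 hAinj)
  set C' := LinearMap.toContinuousLinearMap C with hC'
  have hCA : C'.comp (A p) = 1 := by
    ext1 w
    exact congrArg (fun f => f w) hC
  have hcomp : ContMDiffAt (𝓡 m) 𝓘(ℝ, EuclideanSpace ℝ (Fin m) →L[ℝ] EuclideanSpace ℝ (Fin m)) ∞
      (fun q => C'.comp (A q)) p := contMDiffAt_const.clm_comp hAs
  have hring : ContDiffAt ℝ ∞ (Ring.inverse :
      (EuclideanSpace ℝ (Fin m) →L[ℝ] EuclideanSpace ℝ (Fin m)) → _) (C'.comp (A p)) := by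
    rw [hCA]
    exact contDiffAt_ringInverse ℝ (1 : (EuclideanSpace ℝ (Fin m) →L[ℝ] EuclideanSpace ℝ (Fin m))ˣ)
  have hinv := hring.contMDiffAt.comp p hcomp
  have hunit : ∀ᶠ q in 𝓝 p, IsUnit (C'.comp (A q)) := by
    refine hcomp.continuousAt.eventually (Units.isOpen.mem_nhds ?_)
    change IsUnit (C'.comp (A p))
    rw [hCA]
    exact isUnit_one
  have hfinal : ContMDiffAt (𝓡 m) 𝓘(ℝ, EuclideanSpace ℝ (Fin m)) ∞
      (fun q => Ring.inverse (C'.comp (A q))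
        (C' (tangentCoord (ι p) (mfderiv (𝓡 m) (𝓡 N) ι q (W q))))) p :=
    hinv.clm_apply ((contMDiffAt_const (c := C')).clm_apply hV)
  refine hfinal.congr_of_eventuallyEq ?_
  filter_upwards [hunit, mem_baseSet_nhds (N := m) p,
    (hι.contMDiff p).continuousAt.eventually (mem_baseSet_nhds (N := N) (ι p))] with q h1 h2 h3
  rw [← hAapp q h2 h3]
  exact (congrArg (fun f => f (tangentCoord p (W q))) (Ring.inverse_mul_cancel _ h1)).symm

end AlongImmersion

/-! ### The distribution `D` and the equivalence. -/

section Distribution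

variable {m N q r : ℕ} {M : Type*} [TopologicalSpace M]
    [ChartedSpace (EuclideanSpace ℝ (Fin m)) M] [IsManifold (𝓡 m) ∞ M]
    {Mbar : Type*} [TopologicalSpace Mbar]
    [ChartedSpace (EuclideanSpace ℝ (Fin N)) Mbar] [IsManifold (𝓡 N) ∞ Mbar]
    {K : IndefiniteKaehler N q Mbar} {ι : M → Mbar}

theorem LightlikeSubmanifold.secondFundamentalForm_eq_zero_iff {g : SemiRiemannianMetric N Mbar}
    (L : LightlikeSubmanifold m g ι r)
    (cov : CovariantDerivative (𝓡 N) (EuclideanSpace ℝ (Fin N))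
      (TangentSpace (𝓡 N) : Mbar → Type _)) (X Y : ∀ p : M, TangentSpace (𝓡 m) p) (p : M) :
    L.secondFundamentalForm cov X Y p = 0 ↔ nablaBar cov ι X Y p ∈ tangentField m ι p :=
  Submodule.projection_apply_eq_zero_iff (L.isCompl p)

namespace STCRLightlikeSubmanifold

theorem D_le_tangentField (L : STCRLightlikeSubmanifold m K ι r) (p : M) :
    L.D p ≤ tangentField m ι p := by
  have hS : L.screen p ≤ tangentField m ι p := (L.tangent_eq p).1 ▸ le_sup_left
  have hR : radical m K.g ι p ≤ tangentField m ι p := inf_le_left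
  have hD₀ : L.D₀ p ≤ L.screen p := (L.screen_eq p).1 ▸ le_sup_right
  have hD₁ : L.D₁ p ≤ radical m K.g ι p := (L.radical_eq p).1 ▸ le_sup_left
  exact sup_le (sup_le (hD₀.trans hS) (hD₁.trans hR)) ((L.J_D₁ p).trans hS)

/-- `J` preserves `D₀` and, because `J² = -1`, interchanges `D₁` and `J D₁`. -/
theorem J_mem_D (L : STCRLightlikeSubmanifold m K ι r) {p : M} {z : TangentSpace (𝓡 N) (ι p)}
    (hz : z ∈ L.D p) : K.J (ι p) z ∈ L.D p := by
  obtain ⟨w, hw, j, ⟨a, ha, rfl⟩, rfl⟩ := Submodule.mem_sup.1 hz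
  obtain ⟨b, hb, c, hc, rfl⟩ := Submodule.mem_sup.1 hw
  have h1 : K.J (ι p) b ∈ L.D₀ p := L.J_D₀ p ▸ Submodule.mem_map_of_mem hb
  have h2 : K.J (ι p) (K.J (ι p) a) ∈ L.D₁ p := by
    rw [K.J_sq]
    exact neg_mem ha
  rw [map_add, map_add]
  exact add_mem (add_mem (Submodule.mem_sup_left (Submodule.mem_sup_left h1))
    (Submodule.mem_sup_right (Submodule.mem_map_of_mem hc)))
    (Submodule.mem_sup_left (Submodule.mem_sup_right h2))

/-- `D` is the maximal `J`-invariant subspace field of `TM`. -/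
theorem mem_D_of_J_mem_tangentField (L : STCRLightlikeSubmanifold m K ι r) {p : M}
    {z : TangentSpace (𝓡 N) (ι p)} (hz : z ∈ tangentField m ι p)
    (hJz : K.J (ι p) z ∈ tangentField m ι p) : z ∈ L.D p := by
  rw [← (L.tangent_eq p).1] at hz
  obtain ⟨s, hs, x, hx, rfl⟩ := Submodule.mem_sup.1 hz
  rw [← (L.screen_eq p).1] at hs
  rw [← (L.radical_eq p).1] at hx
  obtain ⟨t, ht, d₀, hd₀, rfl⟩ := Submodule.mem_sup.1 hs
  obtain ⟨j, hj, d', hd', rfl⟩ := Submodule.mem_sup.1 ht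
  obtain ⟨d₁, hd₁, d₂, hd₂, rfl⟩ := Submodule.mem_sup.1 hx
  have hd : d₀ + d₁ + j ∈ L.D p := add_mem (Submodule.mem_sup_left
    (add_mem (Submodule.mem_sup_left hd₀) (Submodule.mem_sup_right hd₁)))
    (Submodule.mem_sup_right hj)
  -- Separate the part in `D` from the part in `D' + D₂`, which `J` sends into `tr(TM)`. As `J z`
  -- and the image of the `D`-part are tangent, `J (d' + d₂)` is both tangent and transversal, hence
  -- zero.
  have hsplit : j + d' + d₀ + (d₁ + d₂) = (d₀ + d₁ + j) + (d' + d₂) := by abel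
  have hJd' : K.J (ι p) d' ∈ L.transversal p := by
    have h : K.J (ι p) d' ∈ L.L₁ p ⊔ L.S p := (L.J_D' p).1 ▸ Submodule.mem_map_of_mem hd'
    exact sup_le_sup (L.L₁_le p) (L.S_le p) h
  have hJd₂ : K.J (ι p) d₂ ∈ L.transversal p :=
    Submodule.mem_sup_right (L.J_D₂ p (Submodule.mem_map_of_mem hd₂))
  have hJ : K.J (ι p) (d' + d₂) = 0 := by
    refine Submodule.disjoint_def.1 (L.isCompl p).disjoint _ ?_ ?_
    · rw [map_add]
      exact add_mem hJd' hJd₂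
    · rw [hsplit, map_add] at hJz
      exact (add_mem_cancel_left (L.D_le_tangentField p (L.J_mem_D hd))).1 hJz
  have h0 : d' + d₂ = 0 := by
    have h := K.J_sq (ι p) (d' + d₂)
    rw [hJ, map_zero] at h
    exact neg_eq_zero.1 h.symm
  rw [hsplit, h0, add_zero]
  exact hd

theorem contMDiff_mfderiv_section (L : STCRLightlikeSubmanifold m K ι r)
    {Y : ∀ p : M, TangentSpace (𝓡 m) p} (hY : IsSection m ι L.D Y) :
    ContMDiff (𝓡 m) (𝓡 N).tangent ∞
      (fun p => (⟨ι p, mfderiv (𝓡 m) (𝓡 N) ι p (Y p)⟩ : TangentBundle (𝓡 N) Mbar)) :=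
  (L.isSubmanifold.contMDiff.contMDiff_tangentMap (m := ∞) (by simp)).comp hY.contMDiff

/-- If `Y` is a section of `D`, so is `J Y`. -/
theorem exists_isSection_J (L : STCRLightlikeSubmanifold m K ι r)
    {Y : ∀ p : M, TangentSpace (𝓡 m) p} (hY : IsSection m ι L.D Y) :
    ∃ W : ∀ p : M, TangentSpace (𝓡 m) p, IsSection m ι L.D W ∧
      ∀ p, mfderiv (𝓡 m) (𝓡 N) ι p (W p) = K.J (ι p) (mfderiv (𝓡 m) (𝓡 N) ι p (Y p)) := by
  have h : ∀ p, ∃ w : TangentSpace (𝓡 m) p,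
      mfderiv (𝓡 m) (𝓡 N) ι p w = K.J (ι p) (mfderiv (𝓡 m) (𝓡 N) ι p (Y p)) :=
    fun p => L.D_le_tangentField p (L.J_mem_D (hY.mem p))
  -- The preimages are chosen point by point; smoothness of `W` comes from that of its image, since
  -- `ι` is an immersion.
  choose W hW using h
  refine ⟨W, ⟨contMDiff_of_mfderiv L.isSubmanifold ?_, fun p => ?_⟩, hW⟩
  · simp only [hW]
    exact (K.J_contMDiff.comp L.isSubmanifold.contMDiff).clm_bundle_apply
      (L.contMDiff_mfderiv_section hY)
  · rw [hW]
    exact L.J_mem_D (hY.mem p)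

/-- The hypothesis is used twice, for `Y` and for the section `W` representing `JY`; the second use
shows that `J ∇bar_X Y` is tangent, and maximality of `D` concludes. -/
theorem nablaBar_mem_D (L : STCRLightlikeSubmanifold m K ι r) (hL : L.IsDGeodesic)
    {X Y : ∀ p : M, TangentSpace (𝓡 m) p} (hX : IsSection m ι L.D X) (hY : IsSection m ι L.D Y)
    (p : M) : nablaBar K.cov ι X Y p ∈ L.D p := by
  have htan : ∀ Z, IsSection m ι L.D Z → nablaBar K.cov ι X Z p ∈ tangentField m ι p :=
    fun Z hZ => (L.secondFundamentalForm_eq_zero_iff K.cov X Z p).1 (hL X Z hX hZ p)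
  obtain ⟨W, hWs, hW⟩ := L.exists_isSection_J hY
  refine L.mem_D_of_J_mem_tangentField (htan Y hY) ?_
  have h : nablaBar K.cov ι X W p = K.J (ι p) (nablaBar K.cov ι X Y p) := by
    have := covAlong_parallel K.cov K.J K.J_contMDiff K.parallel
      ((L.contMDiff_mfderiv_section hY p).mdifferentiableAt (by simp)) (X p)
    simp only [nablaBar, hW]
    exact this
  exact h ▸ htan W hWs

theorem isTotallyGeodesicFoliation_iff (L : STCRLightlikeSubmanifold m K ι r) :
    IsTotallyGeodesicFoliation m K.cov ι L.D ↔ L.IsDGeodesic := by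
  constructor
  · intro h X Y hX hY p
    exact (L.secondFundamentalForm_eq_zero_iff K.cov X Y p).2
      (L.D_le_tangentField p (h.geodesic X Y hX hY p))
  · intro h
    refine ⟨fun X Y hX hY => ⟨fun p => ?_, fun p => ?_⟩, fun X Y hX hY => L.nablaBar_mem_D h hX hY⟩
    · have : IsManifold (𝓡 m) (minSmoothness ℝ 2) M := by
        rw [minSmoothness_of_isRCLikeNormedField]
        infer_instance
      -- The bracket costs one derivative, which is harmless because `∞ + 1` and `∞` agree by
      -- definition.
      have : IsManifold (𝓡 m) (((⊤ : ℕ∞) : WithTop ℕ∞) + 1) M :=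
        inferInstanceAs (IsManifold (𝓡 m) ∞ M)
      exact ContMDiffAt.mlieBracket_vectorField (m := ⊤) (n := ⊤) (hX.contMDiff p) (hY.contMDiff p)
        (by simp)
    · rw [← nablaBar_sub_nablaBar K.leviCivita.torsion_free L.isSubmanifold.contMDiff
        ((hX.contMDiff p).mdifferentiableAt (by simp))
        ((hY.contMDiff p).mdifferentiableAt (by simp))]
      exact sub_mem (L.nablaBar_mem_D h hX hY p) (L.nablaBar_mem_D h hY hX p)

end STCRLightlikeSubmanifold

end Distribution

end STCR

end

theorem theorem3p8 {k q m r : ℕ}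
    {Mbar : Type*} [TopologicalSpace Mbar] [T2Space Mbar] [ParacompactSpace Mbar]
    [ChartedSpace (EuclideanSpace ℝ (Fin (2 * k))) Mbar] [IsManifold (𝓡 (2 * k)) ∞ Mbar]
    {M : Type*} [TopologicalSpace M] [T2Space M] [ParacompactSpace M]
    [ChartedSpace (EuclideanSpace ℝ (Fin m)) M] [IsManifold (𝓡 m) ∞ M]
    (K : STCR.IndefiniteKaehler (2 * k) q Mbar) (ι : M → Mbar)
    (L : STCR.STCRLightlikeSubmanifold m K ι r) :
    STCR.IsTotallyGeodesicFoliation m K.cov ι L.D ↔ L.IsDGeodesic := by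
  exact L.isTotallyGeodesicFoliation_iff
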